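/- **Proposition (Properties of the Poisson bracket).** Let $(M,\Omega)$ be a symplectic manifold, i.e. $M$ is a (Hausdorff, second countable, finite-dimensional) smooth manifold and $\Omega$ is a smooth $2$-form on $M$ which is closed ($\mathrm{d}\Omega=0$) and nondegenerate (for every $q\in M$ the map $T_qM\to T_q^*M$, $v\mapsto\Omega_q(v,\cdot)$, is injective). For $f\in C^\infty(M)=C^\infty(M,\mathbb{R})$ let $X_f$ be the unique smooth vector field on $M$ with $\Omega(X_f,\cdot)=-\mathrm{d}f$, and define the Poisson bracket of $f,g\in C^\infty(M)$ by $$\{f,g\}:=\Omega(X_f,X_g)\in C^\infty(M).$$ Then $\{\cdot,\cdot\}\colon C^\infty(M)\times C^\infty(M)\to C^\infty(M)$ is $\mathbb{R}$-bilinear, it is antisymmetric, i.e. $\{f,g\}=-\{g,f\}$ for all $f,g\in C^\infty(M)$, and it satisfies the Jacobi identity $$\{f,\{g,h\}\}=\{\{f,g\},h\}+\{g,\{f,h\}\}\qquad\text{for all } f,g,h\in C^\infty(M).$$ -/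

import Mathlib

open scoped Manifold ContDiff

noncomputable section

namespace SymplecticGeometry

/-- A vector field on `M`, as a map assigning to each point a tangent vector at this point. -/
abbrev VField (n : ℕ) (M : Type*) [TopologicalSpace M]
    [ChartedSpace (EuclideanSpace ℝ (Fin n)) M] : Type _ :=
  (x : M) → TangentSpace (𝓡 n) x

/-- Smoothness of a vector field, as a section of the tangent bundle. -/
def VField.IsSmooth {n : ℕ} {M : Type*} [TopologicalSpace M]
    [ChartedSpace (EuclideanSpace ℝ (Fin n)) M] [IsManifold (𝓡 n) ∞ M] (X : VField n M) : Prop :=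
  ContMDiff (𝓡 n) (𝓡 n).tangent ∞ (fun x ↦ (⟨x, X x⟩ : TangentBundle (𝓡 n) M))

/-- A smooth differential `2`-form on an `n`-dimensional smooth manifold. -/
structure TwoForm (n : ℕ) (M : Type*) [TopologicalSpace M]
    [ChartedSpace (EuclideanSpace ℝ (Fin n)) M] [IsManifold (𝓡 n) ∞ M] where
  /-- The bilinear form on each tangent space. -/
  toFun (x : M) : TangentSpace (𝓡 n) x →L[ℝ] TangentSpace (𝓡 n) x →L[ℝ] ℝ
  alternating (x : M) (v : TangentSpace (𝓡 n) x) : toFun x v v = 0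
  contMDiff : ContMDiff (𝓡 n)
    ((𝓡 n).prod 𝓘(ℝ, EuclideanSpace ℝ (Fin n) →L[ℝ] EuclideanSpace ℝ (Fin n) →L[ℝ] ℝ)) ∞
    (fun x ↦ Bundle.TotalSpace.mk'
      (EuclideanSpace ℝ (Fin n) →L[ℝ] EuclideanSpace ℝ (Fin n) →L[ℝ] ℝ)
      (E := fun x : M ↦ TangentSpace (𝓡 n) x →L[ℝ] TangentSpace (𝓡 n) x →L[ℝ] ℝ) x (toFun x))

section

variable {n : ℕ} {M : Type*} [TopologicalSpace M]
  [ChartedSpace (EuclideanSpace ℝ (Fin n)) M] [IsManifold (𝓡 n) ∞ M]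

/-- The function `Ω(X, Y)`. -/
def TwoForm.eval (Ω : TwoForm n M) (X Y : VField n M) : M → ℝ :=
  fun x ↦ Ω.toFun x (X x) (Y x)

/-- The function `X(f) = df(X)`. -/
def VField.act (X : VField n M) (f : M → ℝ) : M → ℝ :=
  fun x ↦ mvfderiv (𝓡 n) f x (X x)

/-- The exterior derivative `dΩ` of a `2`-form, evaluated on three vector fields:
`dΩ(X,Y,Z) = X(Ω(Y,Z)) - Y(Ω(X,Z)) + Z(Ω(X,Y)) - Ω([X,Y],Z) + Ω([X,Z],Y) - Ω([Y,Z],X)`. -/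
def TwoForm.extDeriv (Ω : TwoForm n M) (X Y Z : VField n M) : M → ℝ :=
  X.act (Ω.eval Y Z) - Y.act (Ω.eval X Z) + Z.act (Ω.eval X Y)
    - Ω.eval (VectorField.mlieBracket (𝓡 n) X Y) Z
    + Ω.eval (VectorField.mlieBracket (𝓡 n) X Z) Y
    - Ω.eval (VectorField.mlieBracket (𝓡 n) Y Z) X

/-- `dΩ = 0`. -/
def TwoForm.IsClosed (Ω : TwoForm n M) : Prop :=
  ∀ X Y Z : VField n M, X.IsSmooth → Y.IsSmooth → Z.IsSmooth → Ω.extDeriv X Y Z = 0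

/-- For every point `x`, the map `Ω♭ : T_x M → T_x^* M`, `v ↦ Ω(v, ·)`, is injective. -/
def TwoForm.IsNondegenerate (Ω : TwoForm n M) : Prop :=
  ∀ x : M, Function.Injective (Ω.toFun x)

end

/-- A symplectic form: a closed nondegenerate smooth `2`-form. -/
structure SymplecticForm (n : ℕ) (M : Type*) [TopologicalSpace M]
    [ChartedSpace (EuclideanSpace ℝ (Fin n)) M] [IsManifold (𝓡 n) ∞ M] extends TwoForm n M where
  closed : toTwoForm.IsClosed
  nondegenerate : toTwoForm.IsNondegenerate

namespace SymplecticForm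

variable {n : ℕ} {M : Type*} [TopologicalSpace M]
  [ChartedSpace (EuclideanSpace ℝ (Fin n)) M] [IsManifold (𝓡 n) ∞ M]

instance (x : M) : FiniteDimensional ℝ (TangentSpace (𝓡 n) x) :=
  inferInstanceAs (FiniteDimensional ℝ (EuclideanSpace ℝ (Fin n)))

instance (x : M) : T2Space (TangentSpace (𝓡 n) x) :=
  inferInstanceAs (T2Space (EuclideanSpace ℝ (Fin n)))

theorem flat_bijective (Ω : SymplecticForm n M) (x : M) : Function.Bijective (Ω.toFun x) := by
  have h : Module.finrank ℝ (TangentSpace (𝓡 n) x) =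
      Module.finrank ℝ (TangentSpace (𝓡 n) x →L[ℝ] ℝ) := by
    have e : (TangentSpace (𝓡 n) x →ₗ[ℝ] ℝ) ≃ₗ[ℝ] (TangentSpace (𝓡 n) x →L[ℝ] ℝ) :=
      LinearMap.toContinuousLinearMap
    rw [← e.finrank_eq]
    exact (Subspace.dual_finrank_eq (K := ℝ) (V := TangentSpace (𝓡 n) x)).symm
  have hi := Ω.nondegenerate x
  exact ⟨hi, (LinearMap.injective_iff_surjective_of_finrank_eq_finrank
    (f := (Ω.toFun x).toLinearMap) h).1 hi⟩

/-- The isomorphism `Ω♭ : T_x M → T_x^* M`, `v ↦ Ω(v, ·)`. -/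
def flat (Ω : SymplecticForm n M) (x : M) :
    TangentSpace (𝓡 n) x ≃L[ℝ] (TangentSpace (𝓡 n) x →L[ℝ] ℝ) :=
  (LinearEquiv.ofBijective (Ω.toFun x).toLinearMap (Ω.flat_bijective x)).toContinuousLinearEquiv

/-- The Hamiltonian vector field `X_f`: the vector field with `Ω(X_f, ·) = -df`. -/
def hamiltonianField (Ω : SymplecticForm n M) (f : C^∞⟮𝓡 n, M; 𝓘(ℝ, ℝ), ℝ⟯) : VField n M :=
  fun x ↦ (Ω.flat x).symm (-mvfderiv (𝓡 n) f x)

theorem coe_flat (Ω : SymplecticForm n M) (x : M) :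
    ((Ω.flat x : TangentSpace (𝓡 n) x ≃L[ℝ] (TangentSpace (𝓡 n) x →L[ℝ] ℝ)) :
      TangentSpace (𝓡 n) x →L[ℝ] (TangentSpace (𝓡 n) x →L[ℝ] ℝ)) = Ω.toFun x := rfl

theorem toFun_hamiltonianField (Ω : SymplecticForm n M) (f : C^∞⟮𝓡 n, M; 𝓘(ℝ, ℝ), ℝ⟯) (x : M) :
    Ω.toFun x (Ω.hamiltonianField f x) = -mvfderiv (𝓡 n) f x :=
  (Ω.flat x).apply_symm_apply _

theorem contMDiffAt_flat_symm (Ω : SymplecticForm n M) (x₀ : M) :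
    ContMDiffAt (𝓡 n)
      ((𝓡 n).prod 𝓘(ℝ, (EuclideanSpace ℝ (Fin n) →L[ℝ] ℝ) →L[ℝ] EuclideanSpace ℝ (Fin n))) ∞
      (fun x ↦ Bundle.TotalSpace.mk'
        ((EuclideanSpace ℝ (Fin n) →L[ℝ] ℝ) →L[ℝ] EuclideanSpace ℝ (Fin n))
        (E := fun x : M ↦ (TangentSpace (𝓡 n) x →L[ℝ] Bundle.Trivial M ℝ x) →L[ℝ]
          TangentSpace (𝓡 n) x) x
        ((Ω.flat x).symm : (TangentSpace (𝓡 n) x →L[ℝ] ℝ) →L[ℝ] TangentSpace (𝓡 n) x)) x₀ := by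
  have h := Ω.contMDiff x₀
  replace h : ContMDiffAt (𝓡 n)
    ((𝓡 n).prod 𝓘(ℝ, EuclideanSpace ℝ (Fin n) →L[ℝ] EuclideanSpace ℝ (Fin n) →L[ℝ] ℝ)) ∞
    (fun x ↦ Bundle.TotalSpace.mk'
      (EuclideanSpace ℝ (Fin n) →L[ℝ] EuclideanSpace ℝ (Fin n) →L[ℝ] ℝ)
      (E := fun x : M ↦ TangentSpace (𝓡 n) x →L[ℝ] TangentSpace (𝓡 n) x →L[ℝ]
        Bundle.Trivial M ℝ x) x (Ω.toFun x)) x₀ := h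
  rw [contMDiffAt_hom_bundle] at h ⊢
  refine ⟨contMDiffAt_id, ?_⟩
  set F := EuclideanSpace ℝ (Fin n)
  let D : M → Type _ := fun x : M ↦ TangentSpace (𝓡 n) x →L[ℝ] Bundle.Trivial M ℝ x
  have hT : x₀ ∈ (trivializationAt F (TangentSpace (𝓡 n) : M → Type) x₀).baseSet :=
    FiberBundle.mem_baseSet_trivializationAt' x₀
  have hD : x₀ ∈ (trivializationAt (F →L[ℝ] ℝ) D x₀).baseSet :=
    FiberBundle.mem_baseSet_trivializationAt' x₀
  have key : ∀ x ∈ (trivializationAt F (TangentSpace (𝓡 n) : M → Type) x₀).baseSet ∩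
      (trivializationAt (F →L[ℝ] ℝ) D x₀).baseSet,
      (ContinuousLinearMap.inCoordinates F (TangentSpace (𝓡 n) : M → Type) (F →L[ℝ] ℝ) D
        x₀ x x₀ x (Ω.toFun x)).IsInvertible ∧
      ContinuousLinearMap.inCoordinates (F →L[ℝ] ℝ) D F (TangentSpace (𝓡 n) : M → Type)
        x₀ x x₀ x ((Ω.flat x).symm : D x →L[ℝ] TangentSpace (𝓡 n) x) =
      (ContinuousLinearMap.inCoordinates F (TangentSpace (𝓡 n) : M → Type) (F →L[ℝ] ℝ) D
        x₀ x x₀ x (Ω.toFun x)).inverse := by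
    rintro x ⟨h1, h2⟩
    rw [ContinuousLinearMap.inCoordinates_eq h1 h2, ContinuousLinearMap.inCoordinates_eq h2 h1, ← Ω.coe_flat x]
    set a := (trivializationAt F (TangentSpace (𝓡 n) : M → Type) x₀).continuousLinearEquivAt ℝ x h1
    set b := (trivializationAt (F →L[ℝ] ℝ) D x₀).continuousLinearEquivAt ℝ x h2
    have e : (b : D x →L[ℝ] (F →L[ℝ] ℝ)).comp
        (((Ω.flat x : TangentSpace (𝓡 n) x ≃L[ℝ] D x) : TangentSpace (𝓡 n) x →L[ℝ] D x).comp
          (a.symm : F →L[ℝ] TangentSpace (𝓡 n) x)) =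
        ((a.symm.trans ((Ω.flat x).trans b) : F ≃L[ℝ] (F →L[ℝ] ℝ)) : F →L[ℝ] (F →L[ℝ] ℝ)) := rfl
    refine ⟨⟨_, e.symm⟩, ?_⟩
    erw [e]
    rw [ContinuousLinearMap.inverse_equiv]
    rfl
  have hi := (key x₀ ⟨hT, hD⟩).1
  have hs := (ContinuousLinearMap.IsInvertible.contDiffAt_map_inverse (n := ∞) hi).contMDiffAt.comp
    x₀ h.2
  refine hs.congr_of_eventuallyEq ?_
  filter_upwards [((trivializationAt F (TangentSpace (𝓡 n) : M → Type) x₀).open_baseSet.inter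
    (trivializationAt (F →L[ℝ] ℝ) D x₀).open_baseSet).mem_nhds ⟨hT, hD⟩] with x hx
  exact (key x hx).2

theorem contMDiff_mvfderiv (f : C^∞⟮𝓡 n, M; 𝓘(ℝ, ℝ), ℝ⟯) :
    ContMDiff (𝓡 n) ((𝓡 n).prod 𝓘(ℝ, EuclideanSpace ℝ (Fin n) →L[ℝ] ℝ)) ∞
      (fun x ↦ Bundle.TotalSpace.mk' (EuclideanSpace ℝ (Fin n) →L[ℝ] ℝ)
        (E := fun x : M ↦ TangentSpace (𝓡 n) x →L[ℝ] Bundle.Trivial M ℝ x) x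
        (mvfderiv (𝓡 n) f x)) := by
  intro x₀
  rw [contMDiffAt_hom_bundle]
  refine ⟨contMDiffAt_id, ?_⟩
  have h := (f.contMDiff x₀).mfderiv_const (m := ∞) (by simp)
  refine h.congr_of_eventuallyEq (Filter.Eventually.of_forall fun x ↦ ?_)
  simp [inTangentCoordinates, ContinuousLinearMap.inCoordinates, mvfderiv]
  rfl

theorem isSmooth_hamiltonianField (Ω : SymplecticForm n M) (f : C^∞⟮𝓡 n, M; 𝓘(ℝ, ℝ), ℝ⟯) :
    (Ω.hamiltonianField f).IsSmooth := by
  intro x₀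
  have h := contMDiff_mvfderiv (-f) x₀
  simp only [ContMDiffMap.coe_neg, mvfderiv_neg] at h
  exact (Ω.contMDiffAt_flat_symm x₀).clm_bundle_apply h

/-- The Poisson bracket `{f, g} = Ω(X_f, X_g)`, a smooth function on `M`. -/
def poissonBracket (Ω : SymplecticForm n M) (f g : C^∞⟮𝓡 n, M; 𝓘(ℝ, ℝ), ℝ⟯) :
    C^∞⟮𝓡 n, M; 𝓘(ℝ, ℝ), ℝ⟯ where
  val := Ω.eval (Ω.hamiltonianField f) (Ω.hamiltonianField g)
  property := by
    intro x
    have h := ContMDiffAt.clm_bundle_apply₂ (E₃ := Bundle.Trivial M ℝ) (F₃ := ℝ) (Ω.contMDiff x)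
      (Ω.isSmooth_hamiltonianField f x) (Ω.isSmooth_hamiltonianField g x)
    rw [Bundle.contMDiffAt_totalSpace] at h
    exact h.2

end SymplecticForm
end SymplecticGeometry
end

/-! Since `Ω(X_f, ·) = -df`, alternation gives `Ω(Y, X_g) = Y(g)` for every vector field `Y`, so
`{f, g} = X_f(g)`. Linearity in `g` is linearity of the differential, and antisymmetry carries it to
`f`.

The Jacobi identity is `dΩ(X_f, X_g, X_h) = 0` rewritten. Every term `Ω(Y, X_u)` becomes `Y(u)`, and
`[X_f, X_g](h) = {f, {g, h}} - {g, {f, h}}` because the Lie bracket acts as a commutator of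
derivations (`mvfderiv_mlieBracket`). Only nested Poisson brackets remain, and antisymmetry
collapses them. -/

namespace SymplecticGeometry

open VectorField

/-! ### Derivations read in a chart -/

section Chart

variable {E : Type*} [NormedAddCommGroup E] [NormedSpace ℝ E]
  {H : Type*} [TopologicalSpace H] {I : ModelWithCorners ℝ E H}
  {M : Type*} [TopologicalSpace M] [ChartedSpace H M] [IsManifold I 1 M]

/-- The derivative of a function along a vector field, read in an extended chart. -/
theorem fderivWithin_comp_extChartAt_symm_mpullbackWithin (V : (x : M) → TangentSpace I x)
    {f : M → ℝ} {x : M} {y : E} (hy : y ∈ (extChartAt I x).target)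
    (hf : MDifferentiableAt I 𝓘(ℝ, ℝ) f ((extChartAt I x).symm y)) :
    fderivWithin ℝ (f ∘ (extChartAt I x).symm) (Set.range I) y
        (mpullbackWithin 𝓘(ℝ, E) I (extChartAt I x).symm V (Set.range I) y) =
      mvfderiv I f ((extChartAt I x).symm y) (V ((extChartAt I x).symm y)) := by
  have hu : UniqueMDiffWithinAt 𝓘(ℝ, E) (Set.range I) y :=
    I.uniqueMDiffOn _ (extChartAt_target_subset_range x hy)
  have hc := mfderiv_comp_mfderivWithin y hf (mdifferentiableWithinAt_extChartAt_symm hy) hu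
  rw [mfderivWithin_eq_fderivWithin] at hc
  rw [mpullbackWithin_apply]
  refine (DFunLike.congr_fun hc _).trans ?_
  -- The pullback applies the inverse of the derivative of the inverse chart; the chain rule
  -- supplies that derivative, and the two cancel.
  have hi := (isInvertible_mfderivWithin_extChartAt_symm (I := I) hy).self_apply_inverse
    (V ((extChartAt I x).symm y))
  exact congrArg (mfderiv I 𝓘(ℝ, ℝ) f ((extChartAt I x).symm y)) hi

end Chart

/-! ### The Lie bracket as a commutator -/

section Commutator

variable {E : Type*} [NormedAddCommGroup E] [NormedSpace ℝ E] [CompleteSpace E]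
  {H : Type*} [TopologicalSpace H] {I : ModelWithCorners ℝ E H}
  {M : Type*} [TopologicalSpace M] [ChartedSpace H M] [IsManifold I 2 M]

/-- The Lie bracket of vector fields acts on functions as the commutator of derivations. -/
theorem mvfderiv_mlieBracket {V W : (x : M) → TangentSpace I x} {f : M → ℝ} {x : M}
    (hf : ContMDiffAt I 𝓘(ℝ, ℝ) 2 f x)
    (hV : MDifferentiableAt I I.tangent (fun x ↦ (⟨x, V x⟩ : TangentBundle I M)) x)
    (hW : MDifferentiableAt I I.tangent (fun x ↦ (⟨x, W x⟩ : TangentBundle I M)) x)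
    (hVf : MDifferentiableAt I 𝓘(ℝ, ℝ) (fun y ↦ mvfderiv I f y (V y)) x)
    (hWf : MDifferentiableAt I 𝓘(ℝ, ℝ) (fun y ↦ mvfderiv I f y (W y)) x) :
    mvfderiv I f x (mlieBracket I V W x) =
      mvfderiv I (fun y ↦ mvfderiv I f y (W y)) x (V x) -
        mvfderiv I (fun y ↦ mvfderiv I f y (V y)) x (W x) := by
  set φ := extChartAt I x with hφ
  set V' := mpullbackWithin 𝓘(ℝ, E) I φ.symm V (Set.range I)
  set W' := mpullbackWithin 𝓘(ℝ, E) I φ.symm W (Set.range I)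
  have hx : φ x ∈ φ.target := mem_extChartAt_target x
  have hxr : φ x ∈ Set.range I := Set.mem_range_self _
  have hsymm : φ.symm (φ x) = x := extChartAt_to_inv x
  have at_base (U : (x : M) → TangentSpace I x) {g : M → ℝ}
      (hg : MDifferentiableAt I 𝓘(ℝ, ℝ) g x) :
      fderivWithin ℝ (g ∘ φ.symm) (Set.range I) (φ x)
        (mpullbackWithin 𝓘(ℝ, E) I φ.symm U (Set.range I) (φ x)) = mvfderiv I g x (U x) := by
    rw [fderivWithin_comp_extChartAt_symm_mpullbackWithin U hx (by rwa [← hφ, hsymm]), ← hφ,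
      hsymm]
  have hdiff : ∀ᶠ y in nhdsWithin (φ x) (Set.range I),
      y ∈ φ.target ∧ MDifferentiableAt I 𝓘(ℝ, ℝ) f (φ.symm y) := by
    have h1 : ∀ᶠ z in nhds x, MDifferentiableAt I 𝓘(ℝ, ℝ) f z :=
      ((contMDiffAt_iff_contMDiffAt_nhds (by simp)).1 hf).mono fun z hz ↦ hz.mdifferentiableAt (by simp)
    have h2 : Filter.Tendsto φ.symm (nhdsWithin (φ x) (Set.range I)) (nhds x) := by
      have := (continuousAt_extChartAt_symm (I := I) x).tendsto
      rw [extChartAt_to_inv] at this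
      exact this.mono_left nhdsWithin_le_nhds
    exact (Filter.eventually_mem_set.2 (extChartAt_target_mem_nhdsWithin x)).and (h2.eventually h1)
  -- The identity in the model space rests on the symmetry of the second derivative, available
  -- within `Set.range I` because `φ x` lies in the closure of its interior.
  have hlie := fderivWithin_apply_lieBracket (n := 2) (f := f ∘ φ.symm) (s := Set.range I)
    (x := φ x) (V := V') (W := W') ?_ (by simp) I.uniqueDiffOn
    (I.range_subset_closure_interior hxr) hxr ?_ ?_
  -- The chart expression agrees with `U(f)` only near `φ x`, which suffices for differentiating
  -- once more there.
  · have hcongr (U : (x : M) → TangentSpace I x) :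
        (fun y ↦ fderivWithin ℝ (f ∘ φ.symm) (Set.range I) y
          (mpullbackWithin 𝓘(ℝ, E) I φ.symm U (Set.range I) y)) =ᶠ[nhdsWithin (φ x) (Set.range I)]
        (fun z ↦ mvfderiv I f z (U z)) ∘ φ.symm :=
      hdiff.mono fun y hy ↦ fderivWithin_comp_extChartAt_symm_mpullbackWithin U hy.1 hy.2
    rw [(hcongr V).fderivWithin_eq_of_mem hxr, (hcongr W).fderivWithin_eq_of_mem hxr,
      at_base V hWf, at_base W hVf] at hlie
    rw [← hlie, (hf.mdifferentiableAt (by simp)).mvfderiv]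
    -- The derivative of the chart at its own base point is the identity, so no change of frame
    -- remains.
    have hb : mlieBracket I V W x = lieBracketWithin ℝ V' W' (Set.range I) (φ x) := by
      rw [← mlieBracketWithin_univ, mlieBracketWithin_apply, mfderiv_extChartAt_self,
        Set.preimage_univ, Set.univ_inter]
      exact DFunLike.congr_fun (ContinuousLinearMap.inverse_id (R := ℝ) (M := E)) _
    rw [hb]
    rfl
  · exact (contMDiffAt_iff.1 hf).2
  · have := MDifferentiableWithinAt.differentiableWithinAt_mpullbackWithin_vectorField
      (mdifferentiableWithinAt_univ.2 hW)
    rwa [Set.preimage_univ, Set.univ_inter] at this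
  · have := MDifferentiableWithinAt.differentiableWithinAt_mpullbackWithin_vectorField
      (mdifferentiableWithinAt_univ.2 hV)
    rwa [Set.preimage_univ, Set.univ_inter] at this

end Commutator

/-! ### Poisson brackets as derivatives along Hamiltonian fields -/

variable {n : ℕ} {M : Type*} [TopologicalSpace M]
  [ChartedSpace (EuclideanSpace ℝ (Fin n)) M] [IsManifold (𝓡 n) ∞ M]

theorem TwoForm.toFun_swap (Ω : TwoForm n M) (x : M) (v w : TangentSpace (𝓡 n) x) :
    Ω.toFun x v w = -Ω.toFun x w v := by
  have h := Ω.alternating x (v + w)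
  simp only [map_add, add_apply, Ω.alternating] at h
  linarith

namespace SymplecticForm

variable (Ω : SymplecticForm n M) (f g h : C^∞⟮𝓡 n, M; 𝓘(ℝ, ℝ), ℝ⟯)

theorem eval_hamiltonianField_left (Y : VField n M) :
    Ω.eval (Ω.hamiltonianField f) Y = -Y.act f := by
  ext x
  exact DFunLike.congr_fun (Ω.toFun_hamiltonianField f x) (Y x)

theorem eval_hamiltonianField_right (Y : VField n M) :
    Ω.eval Y (Ω.hamiltonianField f) = Y.act f := by
  ext x
  refine (Ω.toFun_swap x _ _).trans ?_
  have := congrFun (Ω.eval_hamiltonianField_left f Y) x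
  exact neg_eq_iff_eq_neg.2 this

theorem coe_poissonBracket :
    (Ω.poissonBracket f g : M → ℝ) = (Ω.hamiltonianField f).act g :=
  Ω.eval_hamiltonianField_right g _

theorem poissonBracket_antisymm : Ω.poissonBracket f g = -Ω.poissonBracket g f := by
  ext x
  exact Ω.toFun_swap x _ _

theorem poissonBracket_add_right :
    Ω.poissonBracket f (g + h) = Ω.poissonBracket f g + Ω.poissonBracket f h := by
  ext x
  simp only [coe_poissonBracket, ContMDiffMap.coe_add, VField.act, Pi.add_apply]
  rw [mvfderiv_add (g.contMDiff.mdifferentiable (by simp) x) (h.contMDiff.mdifferentiable (by simp) x)]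
  rfl

theorem poissonBracket_smul_right (c : ℝ) :
    Ω.poissonBracket f (c • g) = c • Ω.poissonBracket f g := by
  ext x
  simp only [coe_poissonBracket, ContMDiffMap.coe_smul, VField.act, Pi.smul_apply]
  have hg := g.contMDiff.mdifferentiable (by simp) x
  -- Product rule with a constant scalar function, whose differential vanishes.
  have := mvfderiv_smul (mdifferentiableAt_const (c := c)) hg
  rw [mvfderiv_const] at this
  exact (DFunLike.congr_fun this _).trans (by simp)

theorem act_mlieBracket_hamiltonianField :
    VField.act (mlieBracket (𝓡 n) (Ω.hamiltonianField f) (Ω.hamiltonianField g)) h =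
      Ω.poissonBracket f (Ω.poissonBracket g h) - Ω.poissonBracket g (Ω.poissonBracket f h) := by
  ext x
  -- Differentiability of `X_u(h)` is free: it is the smooth function `{u, h}`.
  have hd (u : C^∞⟮𝓡 n, M; 𝓘(ℝ, ℝ), ℝ⟯) :
      MDifferentiableAt (𝓡 n) 𝓘(ℝ, ℝ) ((Ω.hamiltonianField u).act h) x := by
    rw [← coe_poissonBracket]
    exact (Ω.poissonBracket u h).contMDiff.mdifferentiable (by simp) x
  have key := mvfderiv_mlieBracket (h.contMDiff.of_le ENat.LEInfty.out x)
    ((Ω.isSmooth_hamiltonianField f).mdifferentiable (by simp) x)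
    ((Ω.isSmooth_hamiltonianField g).mdifferentiable (by simp) x) (hd f) (hd g)
  simp only [Pi.sub_apply, coe_poissonBracket]
  exact key

theorem poissonBracket_jacobi :
    Ω.poissonBracket f (Ω.poissonBracket g h) =
      Ω.poissonBracket (Ω.poissonBracket f g) h + Ω.poissonBracket g (Ω.poissonBracket f h) := by
  ext x
  have hc := congrFun (Ω.closed _ _ _ (Ω.isSmooth_hamiltonianField f)
    (Ω.isSmooth_hamiltonianField g) (Ω.isSmooth_hamiltonianField h)) x
  simp only [TwoForm.extDeriv, eval_hamiltonianField_right, ← coe_poissonBracket,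
    act_mlieBracket_hamiltonianField, Pi.add_apply, Pi.sub_apply, Pi.zero_apply] at hc
  -- Orienting the inner brackets leaves `-{f, {g, h}} + {g, {f, h}} - {h, {f, g}} = 0` after
  -- cancellation.
  rw [Ω.poissonBracket_antisymm h g, Ω.poissonBracket_antisymm h f,
    Ω.poissonBracket_antisymm g f] at hc
  have hneg (u v : C^∞⟮𝓡 n, M; 𝓘(ℝ, ℝ), ℝ⟯) :
      Ω.poissonBracket u (-v) = -Ω.poissonBracket u v := by
    simpa using Ω.poissonBracket_smul_right u v (-1)
  rw [Ω.poissonBracket_antisymm (Ω.poissonBracket f g) h]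
  simp only [hneg, ContMDiffMap.coe_add, ContMDiffMap.coe_neg, Pi.add_apply, Pi.neg_apply] at hc ⊢
  linarith

end SymplecticForm

end SymplecticGeometry

theorem mainTheorem2 {n : ℕ} {M : Type*} [TopologicalSpace M] [T2Space M]
    [SecondCountableTopology M] [ChartedSpace (EuclideanSpace ℝ (Fin n)) M]
    [IsManifold (𝓡 n) ∞ M] (Ω : SymplecticGeometry.SymplecticForm n M) :
    -- bilinearity over the reals
    (∀ f g h : C^∞⟮𝓡 n, M; 𝓘(ℝ, ℝ), ℝ⟯,
      Ω.poissonBracket (f + g) h = Ω.poissonBracket f h + Ω.poissonBracket g h) ∧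
    (∀ (c : ℝ) (f g : C^∞⟮𝓡 n, M; 𝓘(ℝ, ℝ), ℝ⟯),
      Ω.poissonBracket (c • f) g = c • Ω.poissonBracket f g) ∧
    (∀ f g h : C^∞⟮𝓡 n, M; 𝓘(ℝ, ℝ), ℝ⟯,
      Ω.poissonBracket f (g + h) = Ω.poissonBracket f g + Ω.poissonBracket f h) ∧
    (∀ (c : ℝ) (f g : C^∞⟮𝓡 n, M; 𝓘(ℝ, ℝ), ℝ⟯),
      Ω.poissonBracket f (c • g) = c • Ω.poissonBracket f g) ∧
    -- antisymmetry
    (∀ f g : C^∞⟮𝓡 n, M; 𝓘(ℝ, ℝ), ℝ⟯, Ω.poissonBracket f g = -Ω.poissonBracket g f) ∧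
    -- Jacobi identity
    (∀ f g h : C^∞⟮𝓡 n, M; 𝓘(ℝ, ℝ), ℝ⟯,
      Ω.poissonBracket f (Ω.poissonBracket g h) =
        Ω.poissonBracket (Ω.poissonBracket f g) h + Ω.poissonBracket g (Ω.poissonBracket f h)) := by
  have left_of_right {u v w : C^∞⟮𝓡 n, M; 𝓘(ℝ, ℝ), ℝ⟯}
      (h : -Ω.poissonBracket u v = w) : Ω.poissonBracket v u = w :=
    (Ω.poissonBracket_antisymm v u).trans h
  refine ⟨fun f g h ↦ left_of_right ?_, fun c f g ↦ left_of_right ?_,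
    Ω.poissonBracket_add_right, fun c f g ↦ Ω.poissonBracket_smul_right f g c,
    Ω.poissonBracket_antisymm, Ω.poissonBracket_jacobi⟩
  · rw [Ω.poissonBracket_add_right, neg_add, ← Ω.poissonBracket_antisymm,
      ← Ω.poissonBracket_antisymm]
  · rw [Ω.poissonBracket_smul_right, ← smul_neg, ← Ω.poissonBracket_antisymm]
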